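/- **Theorem ($k,l$-FWL $\cong$ $k{+}1,l$-WL).** Consider finite simple undirected graphs $G=(V,E,X)$ with node features $X_u$ in a fixed set. For $\boldsymbol v\in V^l$ let $G^{\boldsymbol v}$ be the graph $G$ with node features $X^{\boldsymbol v}_u=(X_u,\{i\in[l] : \boldsymbol v_i=u\})$. Write $\{\!\{\cdot\}\!\}$ for multisets and $\psi_i(\boldsymbol a,w)$ for the tuple obtained from $\boldsymbol a$ by replacing its $i$-th entry by $w$. Two $k$-tuples $\boldsymbol a\in V(G)^k$, $\boldsymbol b\in V(H)^k$ have the same isomorphism type if, for all $i,j\in[k]$, $\boldsymbol a_i=\boldsymbol a_j\Leftrightarrow \boldsymbol b_i=\boldsymbol b_j$, the features of $\boldsymbol a_i$ and $\boldsymbol b_i$ agree, and $\boldsymbol a_i\boldsymbol a_j\in E(G)\Leftrightarrow \boldsymbol b_i\boldsymbol b_j\in E(H)$. * For $k\ge 2$, $k$-WL and $k$-FWL color $k$-tuples of nodes. In both, the initial color $c^0(\boldsymbol a,G)$ is the isomorphism type of $\boldsymbol a$. In $k$-WL, $c^{t+1}(\boldsymbol a,G)=\big(c^{t}(\boldsymbol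 a,G),\,(\{\!\{c^{t}(\psi_i(\boldsymbol a,w),G) : w\in V\}\!\})_{i\in[k]}\big)$; in $k$-FWL, $c^{t+1}(\boldsymbol a,G)=\big(c^{t}(\boldsymbol a,G),\,\{\!\{(c^{t}(\psi_i(\boldsymbol a,w),G))_{i\in[k]} : w\in V\}\!\}\big)$. The color of the graph is $c^t(G)=\{\!\{c^t(\boldsymbol a,G):\boldsymbol a\in V^k\}\!\}$. * $1$-WL and $1$-FWL both denote color refinement: $c^0(u,G)=X_u$, $c^{t+1}(u,G)=\big(c^t(u,G),\{\!\{c^t(w,G): uw\in E\}\!\}\big)$, $c^t(G)=\{\!\{c^t(u,G):u\in V\}\!\}$. * $k,l$-WL (respectively $k,l$-FWL) runs $k$-WL (respectively $k$-FWL) on every labeled graph $G^{\boldsymbol v}$ and assigns to $G$ the color $\{\!\{c^t(G^{\boldsymbol v}):\boldsymbol v\in V^l\}\!\}$. Two graphs have the same final color under an algorithm if their colors agree for all sufficiently large $t$. Then for all $k\ge 1$ and $l\ge 0$, $k,l$-FWL is as powerful as $k{+}1,l$-WL: any two graphs $G,H$ have the same final color under $k,l$-FWL if and only if they have the same final color under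 $k{+}1,l$-WL. -/

import Mathlib

universe u v

namespace KLWL

/-- A finite undirected graph `G = (V, E, X)` (no loops, no multiple edges) whose nodes carry
features in `X`. -/
structure FeaturedGraph (X : Type u) where
  V : Type v
  [fintypeV : Fintype V]
  E : SimpleGraph V
  feature : V → X

attribute [instance] FeaturedGraph.fintypeV

/-- A color-producing graph algorithm on graphs with node features in `X`: for every iteration `t`
it assigns to each graph a color. -/
structure Algorithm (X : Type u) where
  Color : ℕ → Type u
  color : (t : ℕ) → FeaturedGraph.{u, v} X → Color t

namespace Algorithm

variable {X : Type u}

/-- `G` and `H` get the same final color: the colors agree as soon as the number of iterations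
is large enough. (For all algorithms below the colorings only get finer with `t`, and on a given
pair of finite graphs they become stable, so this is equality of the stable colors.) -/
def SameFinalColor (A : Algorithm.{u, v} X) (G H : FeaturedGraph.{u, v} X) : Prop :=
  ∀ᶠ t in Filter.atTop, A.color t G = A.color t H

/-- `B ⪯ A` (`A` is more powerful than `B`): any two graphs with the same final color under `A`
have the same final color under `B`. -/
def Preceq (B A : Algorithm.{u, v} X) : Prop :=
  ∀ G H : FeaturedGraph.{u, v} X, A.SameFinalColor G H → B.SameFinalColor G H

/-- `A ≅ B` (`A` is as powerful as `B`). -/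
def AsPowerfulAs (A B : Algorithm.{u, v} X) : Prop :=
  Preceq B A ∧ Preceq A B

end Algorithm

/-! Throughout, `Hash` is an injective hash: it is represented by the tuple or multiset that is
being hashed, so colors are equal exactly when the hashed data are equal. -/

/-- The isomorphism type of a `k`-tuple of nodes: which entries are equal, the features of the
entries, and which entries are adjacent. -/
@[ext]
structure IsoType (k : ℕ) (X : Type u) where
  eq : Fin k → Fin k → Prop
  feature : Fin k → X
  adj : Fin k → Fin k → Prop

section

variable {X : Type u}

def isoType {k : ℕ} (G : FeaturedGraph.{u, v} X) (a : Fin k → G.V) : IsoType k X where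
  eq i j := a i = a j
  feature i := G.feature (a i)
  adj i j := G.E.Adj (a i) (a j)

/-! ### 1-WL (color refinement) -/

def OneWLColor (X : Type u) : ℕ → Type u
  | 0 => X
  | t + 1 => OneWLColor X t × Multiset (OneWLColor X t)

open Classical in
/-- The color of a node: initially its feature, then refined by the multiset of the colors of the
neighbors. -/
noncomputable def nodeColor (G : FeaturedGraph.{u, v} X) : (t : ℕ) → G.V → OneWLColor X t
  | 0, a => G.feature a
  | t + 1, a =>
      (nodeColor G t a, (Finset.univ.filter fun b => G.E.Adj a b).val.map (nodeColor G t))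

/-- 1-WL: the color of a graph is the multiset of its node colors. -/
noncomputable def oneWL (X : Type u) : Algorithm.{u, v} X where
  Color t := Multiset (OneWLColor X t)
  color t G := Finset.univ.val.map (nodeColor G t)

/-! ### Coloring `k`-tuples: the WL update -/

def WLColor (k : ℕ) (X : Type u) : ℕ → Type u
  | 0 => IsoType k X
  | t + 1 => WLColor k X t × (Fin k → Multiset (WLColor k X t))

/-- The color of a `k`-tuple `a` is refined by the sequence, over the positions `i`, of the
multisets over all nodes `w` of the colors of the tuple with `i`-th entry replaced by `w`. -/
def wlColor {k : ℕ} (G : FeaturedGraph.{u, v} X) : (t : ℕ) → (Fin k → G.V) → WLColor k X t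
  | 0, a => isoType G a
  | t + 1, a =>
      (wlColor G t a,
        fun i => Finset.univ.val.map fun w : G.V => wlColor G t (Function.update a i w))

def tupleWL (k : ℕ) (X : Type u) : Algorithm.{u, v} X where
  Color t := Multiset (WLColor k X t)
  color t G := Finset.univ.val.map fun a : Fin k → G.V => wlColor G t a

/-! ### Coloring `k`-tuples: the folklore WL update -/

def FWLColor (k : ℕ) (X : Type u) : ℕ → Type u
  | 0 => IsoType k X
  | t + 1 => FWLColor k X t × Multiset (Fin k → FWLColor k X t)

/-- The color of a `k`-tuple `a` is refined by the multiset, over all nodes `w`, of the sequences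
over the positions `i` of the colors of the tuple with `i`-th entry replaced by `w`. -/
def fwlColor {k : ℕ} (G : FeaturedGraph.{u, v} X) : (t : ℕ) → (Fin k → G.V) → FWLColor k X t
  | 0, a => isoType G a
  | t + 1, a =>
      (fwlColor G t a,
        Finset.univ.val.map fun (w : G.V) (i : Fin k) => fwlColor G t (Function.update a i w))

def tupleFWL (k : ℕ) (X : Type u) : Algorithm.{u, v} X where
  Color t := Multiset (FWLColor k X t)
  color t G := Finset.univ.val.map fun a : Fin k → G.V => fwlColor G t a

/-! ### The algorithms `k`-WL and `k`-FWL

In dimension one, both are color refinement; the tuple updates are used for `k ≥ 2`. (The tuple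
updates for `k = 1` would not look at the edges at all.) -/

noncomputable def kWL (k : ℕ) (X : Type u) : Algorithm.{u, v} X :=
  if k = 1 then oneWL X else tupleWL k X

noncomputable def kFWL (k : ℕ) (X : Type u) : Algorithm.{u, v} X :=
  if k = 1 then oneWL X else tupleFWL k X

/-! ### Labels -/

/-- The labeled graph `G^a`: node `u` gets, as an additional feature, the set of all labels `i`
with `a i = u`. -/
def FeaturedGraph.label {l : ℕ} (G : FeaturedGraph.{u, v} X) (a : Fin l → G.V) :
    FeaturedGraph.{u, v} (X × Set (Fin l)) where
  V := G.V
  E := G.E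
  feature u := (G.feature u, {i | a i = u})

/-- Run an algorithm on all graphs `G^a`, `a ∈ V^l`, and collect the multiset of the colors. -/
def Algorithm.onLabeled {l : ℕ} (A : Algorithm.{u, v} (X × Set (Fin l))) :
    Algorithm.{u, v} X where
  Color t := Multiset (A.Color t)
  color t G := Finset.univ.val.map fun a : Fin l → G.V => A.color t (G.label a)

end

/-- `k,l`-WL: `k`-WL on the `l`-labeled graphs. -/
noncomputable def klWL (k l : ℕ) (X : Type u) : Algorithm.{u, v} X :=
  (kWL k (X × Set (Fin l))).onLabeled

/-- `k,l`-FWL: `k`-FWL on the `l`-labeled graphs. -/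
noncomputable def klFWL (k l : ℕ) (X : Type u) : Algorithm.{u, v} X :=
  (kFWL k (X × Set (Fin l))).onLabeled

end KLWL

namespace KLWL

open Finset

/-! ### Bijections from equalities of multisets -/

theorem exists_equiv_of_map_univ_eq {α β C : Type*} [Fintype α] [Fintype β] (f : α → C)
    (g : β → C) (h : univ.val.map f = univ.val.map g) : ∃ σ : α ≃ β, ∀ a, g (σ a) = f a := by
  classical
  have key (c : C) : Nonempty ({a // f a = c} ≃ {b // g b = c}) := by
    refine ⟨Fintype.equivOfCardEq ?_⟩
    have hc := congrArg (Multiset.count c) h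
    simp only [Multiset.count_map, ← Finset.filter_val, Finset.card_val] at hc
    simpa only [Fintype.card_subtype, eq_comm] using hc
  exact ⟨Equiv.ofFiberEquiv fun c => (key c).some, Equiv.ofFiberEquiv_map _⟩

theorem map_univ_eq_of_equiv {α β C : Type*} [Fintype α] [Fintype β] (f : α → C)
    (g : β → C) (σ : α ≃ β) (h : ∀ a, g (σ a) = f a) : univ.val.map f = univ.val.map g := by
  rw [← Multiset.map_univ_val_equiv σ, Multiset.map_map]
  exact Multiset.map_congr rfl fun a _ => (h a).symm

/-- If the multisets of the colors agree for arbitrarily late colorings in a sequence of colorings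
that get finer and finer, then one bijection matches the colors at all times. -/
theorem exists_equiv_forall_of_eventually {α β : Type*} [Fintype α] [Fintype β] {C : ℕ → Type*}
    (f : ∀ t, α → C t) (g : ∀ t, β → C t)
    (mono : ∀ t a b, f (t + 1) a = g (t + 1) b → f t a = g t b)
    (h : ∀ᶠ t in Filter.atTop, univ.val.map (f t) = univ.val.map (g t)) :
    ∃ σ : α ≃ β, ∀ a t, f t a = g t (σ a) := by
  classical
  by_contra! hcon
  choose a s hs using hcon
  have mono' (a : α) (b : β) (t d : ℕ) (hd : f (t + d) a = g (t + d) b) : f t a = g t b := by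
    induction d with
    | zero => exact hd
    | succ d ih => exact ih (mono _ _ _ hd)
  obtain ⟨T, hT⟩ := Filter.eventually_atTop.1 h
  obtain ⟨σ, hσ⟩ := exists_equiv_of_map_univ_eq _ _ (hT (T + univ.sup s) (Nat.le_add_right _ _))
  have hle : s σ ≤ T + univ.sup s := (Finset.le_sup (mem_univ σ)).trans (Nat.le_add_left _ _)
  obtain ⟨d, hd⟩ := Nat.exists_eq_add_of_le hle
  rw [hd] at hσ
  exact hs σ (mono' _ _ _ d (hσ _).symm)

open Classical in
theorem map_univ_eq_add_map_subtype {α C : Type*} [Fintype α] (p : α → Prop) (f : α → C) :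
    univ.val.map f = (univ.val.map fun a : {a // p a} => f a)
      + univ.val.map fun a : {a // ¬ p a} => f a := by
  rw [← Multiset.map_univ_val_equiv (Equiv.sumCompl p), Multiset.map_map,
    ← Finset.univ_disjSum_univ, Finset.val_disjSum, Multiset.disjSum, Multiset.map_add,
    Multiset.map_map, Multiset.map_map]
  rfl

/-- A color-preserving bijection can be adjusted so as to restrict to a given color-preserving
bijection of subtypes. -/
theorem exists_equiv_extending {α β C : Type*} [Fintype α] [Fintype β] (f : α → C) (g : β → C)
    (p : α → Prop) (q : β → Prop) (σ : α ≃ β) (hσ : ∀ a, g (σ a) = f a)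
    (e : {a // p a} ≃ {b // q b}) (he : ∀ a, g (e a) = f a) :
    ∃ τ : α ≃ β, (∀ a, g (τ a) = f a) ∧ ∀ a, p a ↔ q (τ a) := by
  classical
  have h := map_univ_eq_of_equiv f g σ hσ
  have hp := map_univ_eq_of_equiv (fun a : {a // p a} => f a) (fun b : {b // q b} => g b) e he
  rw [map_univ_eq_add_map_subtype p f, map_univ_eq_add_map_subtype q g, hp] at h
  obtain ⟨e', he'⟩ := exists_equiv_of_map_univ_eq _ _ (add_left_cancel h)
  refine ⟨(Equiv.sumCompl p).symm.trans ((e.sumCongr e').trans (Equiv.sumCompl q)), ?_, ?_⟩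
  · intro a
    by_cases ha : p a
    · simpa [ha] using he ⟨a, ha⟩
    · simpa [ha] using he' ⟨a, ha⟩
  · intro a
    by_cases ha : p a
    · simpa [ha] using (e ⟨a, ha⟩).2
    · simpa [ha] using (e' ⟨a, ha⟩).2

/-- If related tuples stay related when an entry is replaced, along some bijection of the nodes,
then all tuples are related along some bijection. -/
theorem exists_tuple_equiv {V W : Type*} {n : ℕ} (R : (Fin n → V) → (Fin n → W) → Prop)
    (step : ∀ a b, R a b → ∀ i, ∃ σ : V ≃ W, ∀ w,
      R (Function.update a i w) (Function.update b i (σ w)))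
    (a : Fin n → V) (b : Fin n → W) (h : R a b) :
    ∃ τ : (Fin n → V) ≃ (Fin n → W), ∀ x, R x (τ x) := by
  induction n with
  | zero =>
    refine ⟨Equiv.ofUnique _ _, fun x => ?_⟩
    convert! h
  | succ n ih =>
    obtain ⟨σ, hσ⟩ := step a b h 0
    have key (w : V) : ∃ τ : (Fin n → V) ≃ (Fin n → W),
        ∀ x, R (Fin.cons w x) (Fin.cons (σ w) (τ x)) := by
      refine ih (fun x y => R (Fin.cons w x) (Fin.cons (σ w) y)) ?_ (Fin.tail a) (Fin.tail b) ?_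
      · intro x y hxy i
        simpa only [Fin.cons_update] using step _ _ hxy i.succ
      · have := hσ w
        rw [← Fin.cons_self_tail a, ← Fin.cons_self_tail b] at this
        simpa only [Fin.update_cons_zero] using this
    choose τ hτ using key
    refine ⟨(Fin.consEquiv fun _ => V).symm.trans
      ((Equiv.prodShear σ τ).trans (Fin.consEquiv fun _ => W)), fun x => ?_⟩
    have := hτ (x 0) (Fin.tail x)
    rw [Fin.cons_self_tail] at this
    exact this

theorem comp_update_of_notMem {k n : ℕ} {V : Type*} (c : Fin n → V) (f : Fin k → Fin n)
    (i : Fin k) (j : Fin n) (hj : ∀ p, p ≠ i → f p ≠ j) (w : V) :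
    Function.update (c ∘ f) i w = Function.update c j w ∘ Function.update f i j := by
  funext p
  by_cases hp : p = i
  · subst hp; simp
  · simp [hp, hj p hp]

theorem exists_forall_ne {k n : ℕ} (f : Fin k → Fin n) (hkn : k < n) : ∃ j, ∀ p, f p ≠ j := by
  by_contra! h
  have := Fintype.card_le_of_surjective f h
  simp at this
  omega

theorem exists_forall_ne_of_ne {k n : ℕ} (f : Fin k → Fin n) (hkn : k ≤ n) (i : Fin k) :
    ∃ j, ∀ p, p ≠ i → f p ≠ j := by
  classical
  by_contra! h
  have hsub : (univ : Finset (Fin n)) ⊆ (univ.erase i).image f := by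
    intro j _
    obtain ⟨p, hp, hj⟩ := h j
    exact mem_image.2 ⟨p, by simp [hp], hj⟩
  have h1 := (card_le_card hsub).trans card_image_le
  rw [card_erase_of_mem (mem_univ i)] at h1
  simp at h1
  have := i.pos
  omega

variable {X : Type u}

theorem isoType_comp {k n : ℕ} {G H : FeaturedGraph.{u, v} X} {c : Fin n → G.V} {d : Fin n → H.V}
    (h : isoType G c = isoType H d) (f : Fin k → Fin n) :
    isoType G (c ∘ f) = isoType H (d ∘ f) := by
  have h1 := congrArg IsoType.eq h
  have h2 := congrArg IsoType.feature h
  have h3 := congrArg IsoType.adj h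
  ext i j
  · exact iff_of_eq (congrFun (congrFun h1 (f i)) (f j))
  · exact congrFun h2 (f i)
  · exact iff_of_eq (congrFun (congrFun h3 (f i)) (f j))

/-- The isomorphism types agree once they agree on all pairs of entries. -/
theorem isoType_eq_of_comp {k n : ℕ} (hk : 2 ≤ k) {G H : FeaturedGraph.{u, v} X}
    {c : Fin n → G.V} {d : Fin n → H.V}
    (h : ∀ f : Fin k → Fin n, isoType G (c ∘ f) = isoType H (d ∘ f)) :
    isoType G c = isoType H d := by
  have hpair (p q : Fin n) : ∃ (f : Fin k → Fin n) (i j : Fin k), f i = p ∧ f j = q :=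
    ⟨Function.update (fun _ => q) ⟨0, by omega⟩ p, ⟨0, by omega⟩, ⟨1, by omega⟩, by simp,
      by simp⟩
  ext p q
  · obtain ⟨f, i, j, rfl, rfl⟩ := hpair p q
    exact iff_of_eq (congrFun (congrFun (congrArg IsoType.eq (h f)) i) j)
  · obtain ⟨f, i, j, rfl, -⟩ := hpair p p
    exact congrFun (congrArg IsoType.feature (h f)) i
  · obtain ⟨f, i, j, rfl, rfl⟩ := hpair p q
    exact iff_of_eq (congrFun (congrFun (congrArg IsoType.adj (h f)) i) j)

/-! ### Equal colors at all times, as greatest bisimulations -/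

section Equivalences

variable {k : ℕ} (G H : FeaturedGraph.{u, v} X)

def WLEquiv (a : Fin k → G.V) (b : Fin k → H.V) : Prop :=
  ∀ t, wlColor G t a = wlColor H t b

def FWLEquiv (a : Fin k → G.V) (b : Fin k → H.V) : Prop :=
  ∀ t, fwlColor G t a = fwlColor H t b

def NodeEquiv (a : G.V) (b : H.V) : Prop :=
  ∀ t, nodeColor G t a = nodeColor H t b

variable {G H}

theorem WLEquiv.isoType_eq {a : Fin k → G.V} {b : Fin k → H.V} (h : WLEquiv G H a b) :
    isoType G a = isoType H b := h 0

theorem FWLEquiv.isoType_eq {a : Fin k → G.V} {b : Fin k → H.V} (h : FWLEquiv G H a b) :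
    isoType G a = isoType H b := h 0

theorem wlColor_eq_of_succ {t : ℕ} {a : Fin k → G.V} {b : Fin k → H.V}
    (h : wlColor G (t + 1) a = wlColor H (t + 1) b) : wlColor G t a = wlColor H t b :=
  congrArg Prod.fst h

theorem fwlColor_eq_of_succ {t : ℕ} {a : Fin k → G.V} {b : Fin k → H.V}
    (h : fwlColor G (t + 1) a = fwlColor H (t + 1) b) : fwlColor G t a = fwlColor H t b :=
  congrArg Prod.fst h

theorem nodeColor_eq_of_succ {t : ℕ} {a : G.V} {b : H.V}
    (h : nodeColor G (t + 1) a = nodeColor H (t + 1) b) : nodeColor G t a = nodeColor H t b :=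
  congrArg Prod.fst h

theorem WLEquiv.exists_equiv {a : Fin k → G.V} {b : Fin k → H.V} (h : WLEquiv G H a b)
    (i : Fin k) :
    ∃ σ : G.V ≃ H.V, ∀ w, WLEquiv G H (Function.update a i w) (Function.update b i (σ w)) :=
  exists_equiv_forall_of_eventually (fun t w => wlColor G t (Function.update a i w))
    (fun t w => wlColor H t (Function.update b i w)) (fun _ _ _ => wlColor_eq_of_succ)
    (.of_forall fun t => congrFun (congrArg Prod.snd (h (t + 1))) i)

theorem FWLEquiv.exists_equiv {a : Fin k → G.V} {b : Fin k → H.V} (h : FWLEquiv G H a b) :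
    ∃ σ : G.V ≃ H.V, ∀ w i,
      FWLEquiv G H (Function.update a i w) (Function.update b i (σ w)) := by
  obtain ⟨σ, hσ⟩ := exists_equiv_forall_of_eventually
    (fun t w (i : Fin k) => fwlColor G t (Function.update a i w))
    (fun t w (i : Fin k) => fwlColor H t (Function.update b i w))
    (fun _ _ _ h' => funext fun i => fwlColor_eq_of_succ (congrFun h' i))
    (.of_forall fun t => congrArg Prod.snd (h (t + 1)))
  exact ⟨σ, fun w i t => congrFun (hσ w t) i⟩

open Classical in
theorem nodeColor_succ_snd (t : ℕ) (a : G.V) :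
    (nodeColor G (t + 1) a).2 =
      (univ : Finset {w // G.E.Adj a w}).val.map fun w => nodeColor G t w.1 := by
  change (univ.filter fun b => G.E.Adj a b).val.map (nodeColor G t) = _
  rw [← Finset.subtype_map, Finset.map_val, Multiset.map_map, Finset.subtype_univ]
  rfl

theorem NodeEquiv.exists_equiv {a : G.V} {b : H.V} (h : NodeEquiv G H a b) :
    ∃ e : {w // G.E.Adj a w} ≃ {w // H.E.Adj b w}, ∀ w, NodeEquiv G H w.1 (e w).1 := by
  classical
  refine exists_equiv_forall_of_eventually (fun t (w : {w // G.E.Adj a w}) => nodeColor G t w)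
    (fun t (w : {w // H.E.Adj b w}) => nodeColor H t w) (fun _ _ _ => nodeColor_eq_of_succ)
    (.of_forall fun t => ?_)
  rw [← nodeColor_succ_snd, ← nodeColor_succ_snd, h (t + 1)]

theorem wlEquiv_of_bisimulation (R : (Fin k → G.V) → (Fin k → H.V) → Prop)
    (iso : ∀ a b, R a b → isoType G a = isoType H b)
    (step : ∀ a b, R a b → ∀ i, ∃ σ : G.V ≃ H.V, ∀ w,
      R (Function.update a i w) (Function.update b i (σ w)))
    {a : Fin k → G.V} {b : Fin k → H.V} (h : R a b) : WLEquiv G H a b := by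
  intro t
  induction t generalizing a b with
  | zero => exact iso a b h
  | succ t ih =>
    refine Prod.ext (ih h) (funext fun i => ?_)
    obtain ⟨σ, hσ⟩ := step a b h i
    exact map_univ_eq_of_equiv _ _ σ fun w => (ih (hσ w)).symm

theorem fwlEquiv_of_bisimulation (R : (Fin k → G.V) → (Fin k → H.V) → Prop)
    (iso : ∀ a b, R a b → isoType G a = isoType H b)
    (step : ∀ a b, R a b → ∃ σ : G.V ≃ H.V, ∀ w i,
      R (Function.update a i w) (Function.update b i (σ w)))
    {a : Fin k → G.V} {b : Fin k → H.V} (h : R a b) : FWLEquiv G H a b := by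
  intro t
  induction t generalizing a b with
  | zero => exact iso a b h
  | succ t ih =>
    refine Prod.ext (ih h) ?_
    obtain ⟨σ, hσ⟩ := step a b h
    exact map_univ_eq_of_equiv _ _ σ fun w => funext fun i => (ih (hσ w i)).symm

theorem nodeEquiv_of_bisimulation (R : G.V → H.V → Prop)
    (feature : ∀ a b, R a b → G.feature a = H.feature b)
    (step : ∀ a b, R a b → ∃ e : {w // G.E.Adj a w} ≃ {w // H.E.Adj b w}, ∀ w, R w.1 (e w).1)
    {a : G.V} {b : H.V} (h : R a b) : NodeEquiv G H a b := by
  classical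
  intro t
  induction t generalizing a b with
  | zero => exact feature a b h
  | succ t ih =>
    refine Prod.ext (ih h) ?_
    rw [nodeColor_succ_snd, nodeColor_succ_snd]
    obtain ⟨e, he⟩ := step a b h
    exact map_univ_eq_of_equiv _ _ e fun w => (ih (he w)).symm

end Equivalences

/-! ### Comparison of the equivalences on tuples -/

section Comparison

variable {k : ℕ} {G H : FeaturedGraph.{u, v} X}

theorem FWLEquiv.comp {a : Fin k → G.V} {b : Fin k → H.V} (h : FWLEquiv G H a b)
    (f : Fin k → Fin k) : FWLEquiv G H (a ∘ f) (b ∘ f) := by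
  refine fwlEquiv_of_bisimulation
    (fun x y => ∃ a b, FWLEquiv G H a b ∧ ∃ f : Fin k → Fin k, x = a ∘ f ∧ y = b ∘ f)
    ?_ ?_ ⟨a, b, h, f, rfl, rfl⟩
  · rintro _ _ ⟨a, b, h, f, rfl, rfl⟩
    exact isoType_comp h.isoType_eq f
  · rintro _ _ ⟨a, b, h, f, rfl, rfl⟩
    obtain ⟨σ, hσ⟩ := h.exists_equiv
    refine ⟨σ, fun w i => ?_⟩
    obtain ⟨j, hj⟩ := exists_forall_ne_of_ne f le_rfl i
    exact ⟨_, _, hσ w j, Function.update f i j, comp_update_of_notMem _ _ _ _ hj _,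
      comp_update_of_notMem _ _ _ _ hj _⟩

theorem WLEquiv.fwlEquiv_comp {c : Fin (k + 1) → G.V} {d : Fin (k + 1) → H.V}
    (h : WLEquiv G H c d) (f : Fin k → Fin (k + 1)) : FWLEquiv G H (c ∘ f) (d ∘ f) := by
  refine fwlEquiv_of_bisimulation
    (fun x y => ∃ c d, WLEquiv G H c d ∧ ∃ f : Fin k → Fin (k + 1), x = c ∘ f ∧ y = d ∘ f)
    ?_ ?_ ⟨c, d, h, f, rfl, rfl⟩
  · rintro _ _ ⟨c, d, h, f, rfl, rfl⟩
    exact isoType_comp h.isoType_eq f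
  · rintro _ _ ⟨c, d, h, f, rfl, rfl⟩
    obtain ⟨j, hj⟩ := exists_forall_ne f (Nat.lt_succ_self k)
    obtain ⟨σ, hσ⟩ := h.exists_equiv j
    exact ⟨σ, fun w i => ⟨_, _, hσ w, Function.update f i j,
      comp_update_of_notMem _ _ _ _ (fun p _ => hj p) _,
      comp_update_of_notMem _ _ _ _ (fun p _ => hj p) _⟩⟩

theorem exists_update_comp_eq (i : Fin (k + 1)) (j : Fin k) (f : Fin k → Fin (k + 1))
    (hf : ∀ p, f p ≠ i.succAbove j) :
    ∃ g : Fin k → Fin k, ∀ {V : Type v} (c : Fin (k + 1) → V) (w : V),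
      Function.update c i w ∘ f = Function.update (c ∘ i.succAbove) j w ∘ g := by
  have key (p : Fin k) : ∃ q, ∀ {V : Type v} (c : Fin (k + 1) → V) (w : V),
      Function.update c i w (f p) = Function.update (c ∘ i.succAbove) j w q := by
    by_cases hp : f p = i
    · exact ⟨j, fun _ _ => by simp [hp]⟩
    · obtain ⟨q, hq⟩ := Fin.exists_succAbove_eq hp
      have hqj : q ≠ j := fun h => hf p (by rw [← hq, h])
      exact ⟨q, fun _ _ => by simp [← hq, hqj]⟩
  choose g hg using key
  exact ⟨g, fun _ _ => funext fun p => hg p _ _⟩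

theorem wlEquiv_of_forall_fwlEquiv_comp (hk : 2 ≤ k) {c : Fin (k + 1) → G.V}
    {d : Fin (k + 1) → H.V} (h : ∀ f : Fin k → Fin (k + 1), FWLEquiv G H (c ∘ f) (d ∘ f)) :
    WLEquiv G H c d := by
  refine wlEquiv_of_bisimulation
    (fun c d => ∀ f : Fin k → Fin (k + 1), FWLEquiv G H (c ∘ f) (d ∘ f)) ?_ ?_ h
  · exact fun c d h => isoType_eq_of_comp hk fun f => (h f).isoType_eq
  · intro c d h i
    obtain ⟨σ, hσ⟩ := (h i.succAbove).exists_equiv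
    refine ⟨σ, fun w f => ?_⟩
    obtain ⟨m, hm⟩ := exists_forall_ne f (Nat.lt_succ_self k)
    by_cases hmi : m = i
    · have key {V : Type v} (c : Fin (k + 1) → V) (w : V) : Function.update c i w ∘ f = c ∘ f :=
        funext fun p => Function.update_of_ne (hmi ▸ hm p) _ _
      rw [key, key]
      exact h f
    · obtain ⟨j, rfl⟩ := Fin.exists_succAbove_eq hmi
      obtain ⟨g, hg⟩ := exists_update_comp_eq i j f hm
      rw [hg, hg]
      exact (hσ w j).comp g

/-- In dimension one: given a bijection of the nodes that preserves the colors, pairs with the same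
isomorphism type whose entries have the same colors have the same color. -/
theorem wlEquiv_two_of_nodeEquiv (τ : G.V ≃ H.V) (hτ : ∀ w, NodeEquiv G H w (τ w))
    {c : Fin 2 → G.V} {d : Fin 2 → H.V} (iso : isoType G c = isoType H d)
    (h : ∀ i, NodeEquiv G H (c i) (d i)) : WLEquiv G H c d := by
  classical
  refine wlEquiv_of_bisimulation
    (fun c d => isoType G c = isoType H d ∧ ∀ i, NodeEquiv G H (c i) (d i)) (fun _ _ h => h.1) ?_
    ⟨iso, h⟩
  rintro c d ⟨-, h⟩ i
  obtain ⟨o, hoi, ho⟩ : ∃ o : Fin 2, o ≠ i ∧ ∀ p, p ≠ i → p = o := by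
    refine ⟨1 - i, ?_, ?_⟩ <;> revert i <;> decide
  obtain ⟨e, he⟩ := (h o).exists_equiv
  obtain ⟨ρ, hρ, hadj⟩ := exists_equiv_extending (fun w t => nodeColor G t w)
    (fun w t => nodeColor H t w) (G.E.Adj (c o)) (H.E.Adj (d o)) τ
    (fun w => funext fun t => (hτ w t).symm) e (fun w => funext fun t => (he w t).symm)
  obtain ⟨σ, hσ, hσadj, hσo⟩ : ∃ σ : G.V ≃ H.V, (∀ w, NodeEquiv G H w (σ w)) ∧
      (∀ w, G.E.Adj (c o) w ↔ H.E.Adj (d o) (σ w)) ∧ σ (c o) = d o := by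
    have hnot : ¬ H.E.Adj (d o) (ρ (c o)) := fun h' => G.E.loopless.irrefl _ ((hadj _).2 h')
    refine ⟨ρ.trans (Equiv.swap (ρ (c o)) (d o)), fun w t => ?_, fun w => ?_, by simp⟩
    · have hw := (congrFun (hρ w) t).symm
      simp only [Equiv.trans_apply]
      rw [Equiv.swap_apply_def]
      split_ifs with h1 h2
      · rw [ρ.injective h1]; exact h o t
      · rw [hw, h2, ← h o t]; exact congrFun (hρ (c o)) t |>.symm
      · exact hw
    · rw [hadj w, Equiv.trans_apply, Equiv.swap_apply_def]
      split_ifs with h1 h2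
      · simp [h1, hnot]
      · simp [h2, hnot]
      · rfl
  refine ⟨σ, fun w => ⟨?_, fun p => ?_⟩⟩
  · have heq : w = c o ↔ σ w = d o := by rw [← hσo, σ.injective.eq_iff]
    ext p q
    · by_cases hp : p = i <;> by_cases hq : q = i
      · simp [isoType, hp, hq]
      · obtain rfl := ho q hq
        simpa [isoType, hp, hoi] using heq
      · obtain rfl := ho p hp
        simpa [isoType, hq, hoi, eq_comm] using heq
      · simp [isoType, ho p hp, ho q hq]
    · by_cases hp : p = i
      · simpa [isoType, hp] using show G.feature w = H.feature (σ w) from hσ w 0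
      · obtain rfl := ho p hp
        simpa [isoType, hoi] using show G.feature (c p) = H.feature (d p) from h p 0
    · by_cases hp : p = i <;> by_cases hq : q = i
      · simp [isoType, hp, hq]
      · obtain rfl := ho q hq
        simpa [isoType, hp, hoi, SimpleGraph.adj_comm] using hσadj w
      · obtain rfl := ho p hp
        simpa [isoType, hq, hoi] using hσadj w
      · simp [isoType, ho p hp, ho q hq]
  · by_cases hp : p = i
    · simpa [hp] using hσ w
    · simpa [hp] using h p

theorem WLEquiv.nodeEquiv {c : Fin 2 → G.V} {d : Fin 2 → H.V} (h : WLEquiv G H c d) (i : Fin 2) :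
    NodeEquiv G H (c i) (d i) := by
  refine nodeEquiv_of_bisimulation
    (fun a b => ∃ c d, WLEquiv (k := 2) G H c d ∧ ∃ i, a = c i ∧ b = d i) ?_ ?_
    ⟨c, d, h, i, rfl, rfl⟩
  · rintro _ _ ⟨c, d, h, i, rfl, rfl⟩
    exact congrFun (congrArg IsoType.feature h.isoType_eq) i
  · rintro _ _ ⟨c, d, h, i, rfl, rfl⟩
    obtain ⟨j, hj⟩ := exists_ne i
    obtain ⟨σ, hσ⟩ := h.exists_equiv j
    have hadj (w : G.V) : G.E.Adj (c i) w ↔ H.E.Adj (d i) (σ w) := by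
      have := iff_of_eq
        (congrFun (congrFun (congrArg IsoType.adj (hσ w).isoType_eq) i) j)
      simpa [isoType, hj.symm] using this
    exact ⟨σ.subtypeEquiv hadj, fun w => ⟨_, _, hσ w, j, by simp, by simp⟩⟩

end Comparison

/-! ### Final colors of graphs -/

namespace Algorithm

/-- The colors of graphs get finer with the number of iterations. -/
def Refining (A : Algorithm.{u, v} X) : Prop :=
  ∀ t (G H : FeaturedGraph.{u, v} X), A.color (t + 1) G = A.color (t + 1) H →
    A.color t G = A.color t H

theorem sameFinalColor_onLabeled_iff {l : ℕ} {A : Algorithm.{u, v} (X × Set (Fin l))}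
    (hA : A.Refining) (G H : FeaturedGraph.{u, v} X) :
    A.onLabeled.SameFinalColor G H ↔ ∃ σ : (Fin l → G.V) ≃ (Fin l → H.V),
      ∀ a, A.SameFinalColor (G.label a) (H.label (σ a)) := by
  constructor
  · intro h
    obtain ⟨σ, hσ⟩ := exists_equiv_forall_of_eventually
      (fun t (a : Fin l → G.V) => A.color t (G.label a))
      (fun t (a : Fin l → H.V) => A.color t (H.label a)) (fun t _ _ => hA t _ _) h
    exact ⟨σ, fun a => .of_forall (hσ a)⟩
  · rintro ⟨σ, hσ⟩
    filter_upwards [Filter.eventually_all.2 hσ] with t ht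
    exact map_univ_eq_of_equiv _ _ σ fun a => (ht a).symm

theorem AsPowerfulAs.onLabeled {l : ℕ} {A B : Algorithm.{u, v} (X × Set (Fin l))}
    (hA : A.Refining) (hB : B.Refining) (h : A.AsPowerfulAs B) :
    A.onLabeled.AsPowerfulAs B.onLabeled := by
  constructor <;> intro G H <;>
    rw [sameFinalColor_onLabeled_iff hA, sameFinalColor_onLabeled_iff hB]
  · exact fun ⟨σ, hσ⟩ => ⟨σ, fun a => h.1 _ _ (hσ a)⟩
  · exact fun ⟨σ, hσ⟩ => ⟨σ, fun a => h.2 _ _ (hσ a)⟩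

end Algorithm

theorem map_eq_of_map_eq_of_fst {α β C D : Type*} {s : Multiset α} {s' : Multiset β}
    {f : α → C × D} {g : β → C × D} (h : s.map f = s'.map g) :
    (s.map fun a => (f a).1) = s'.map fun b => (g b).1 := by
  simpa only [Multiset.map_map, Function.comp_def] using congrArg (Multiset.map Prod.fst) h

theorem oneWL_refining (X : Type u) : (oneWL.{u, v} X).Refining :=
  fun _ _ _ h => map_eq_of_map_eq_of_fst h

theorem tupleWL_refining (k : ℕ) (X : Type u) : (tupleWL.{u, v} k X).Refining :=
  fun _ _ _ h => map_eq_of_map_eq_of_fst h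

theorem tupleFWL_refining (k : ℕ) (X : Type u) : (tupleFWL.{u, v} k X).Refining :=
  fun _ _ _ h => map_eq_of_map_eq_of_fst h

section FinalColor

variable {k : ℕ} (G H : FeaturedGraph.{u, v} X)

theorem oneWL_sameFinalColor_iff :
    (oneWL X).SameFinalColor G H ↔ ∃ τ : G.V ≃ H.V, ∀ w, NodeEquiv G H w (τ w) := by
  constructor
  · exact exists_equiv_forall_of_eventually (nodeColor G) (nodeColor H)
      fun _ _ _ => nodeColor_eq_of_succ
  · rintro ⟨τ, hτ⟩
    exact .of_forall fun t => map_univ_eq_of_equiv _ _ τ fun w => (hτ w t).symm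

theorem tupleWL_sameFinalColor_iff :
    (tupleWL k X).SameFinalColor G H ↔
      ∃ τ : (Fin k → G.V) ≃ (Fin k → H.V), ∀ a, WLEquiv G H a (τ a) := by
  constructor
  · exact exists_equiv_forall_of_eventually (fun t (a : Fin k → G.V) => wlColor G t a)
      (fun t (a : Fin k → H.V) => wlColor H t a) fun _ _ _ => wlColor_eq_of_succ
  · rintro ⟨τ, hτ⟩
    exact .of_forall fun t => map_univ_eq_of_equiv _ _ τ fun a => (hτ a t).symm

theorem tupleFWL_sameFinalColor_iff :
    (tupleFWL k X).SameFinalColor G H ↔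
      ∃ τ : (Fin k → G.V) ≃ (Fin k → H.V), ∀ a, FWLEquiv G H a (τ a) := by
  constructor
  · exact exists_equiv_forall_of_eventually (fun t (a : Fin k → G.V) => fwlColor G t a)
      (fun t (a : Fin k → H.V) => fwlColor H t a) fun _ _ _ => fwlColor_eq_of_succ
  · rintro ⟨τ, hτ⟩
    exact .of_forall fun t => map_univ_eq_of_equiv _ _ τ fun a => (hτ a t).symm

theorem exists_equiv_forall_iff {V W : Type*} (hk : 1 ≤ k) (R : (Fin k → V) → (Fin k → W) → Prop)
    (step : ∀ a b, R a b → ∀ i, ∃ σ : V ≃ W, ∀ w,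
      R (Function.update a i w) (Function.update b i (σ w))) :
    (∃ τ : (Fin k → V) ≃ (Fin k → W), ∀ a, R a (τ a)) ↔
      (IsEmpty V ∧ IsEmpty W) ∨ ∃ a b, R a b := by
  have : Nonempty (Fin k) := ⟨⟨0, hk⟩⟩
  constructor
  · rintro ⟨τ, hτ⟩
    rcases isEmpty_or_nonempty V with hV | ⟨⟨x⟩⟩
    · refine .inl ⟨hV, ⟨fun y => ?_⟩⟩
      exact hV.false (τ.symm (fun _ => y) (Classical.arbitrary _))
    · exact .inr ⟨fun _ => x, _, hτ _⟩
  · rintro (⟨hV, hW⟩ | ⟨a, b, hab⟩)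
    · exact ⟨Equiv.equivOfIsEmpty _ _, fun a => isEmptyElim a⟩
    · exact exists_tuple_equiv R step a b hab

theorem tupleWL_sameFinalColor_iff_exists (hk : 1 ≤ k) :
    (tupleWL k X).SameFinalColor G H ↔
      (IsEmpty G.V ∧ IsEmpty H.V) ∨ ∃ a b, WLEquiv (k := k) G H a b := by
  rw [tupleWL_sameFinalColor_iff]
  exact exists_equiv_forall_iff hk _ fun _ _ h => h.exists_equiv

theorem tupleFWL_sameFinalColor_iff_exists (hk : 1 ≤ k) :
    (tupleFWL k X).SameFinalColor G H ↔
      (IsEmpty G.V ∧ IsEmpty H.V) ∨ ∃ a b, FWLEquiv (k := k) G H a b := by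
  rw [tupleFWL_sameFinalColor_iff]
  exact exists_equiv_forall_iff hk _ fun _ _ h i => h.exists_equiv.imp fun _ hσ w => hσ w i

theorem tupleFWL_sameFinalColor_iff_tupleWL (hk : 2 ≤ k) :
    (tupleFWL k X).SameFinalColor G H ↔ (tupleWL (k + 1) X).SameFinalColor G H := by
  rw [tupleFWL_sameFinalColor_iff_exists G H (by omega),
    tupleWL_sameFinalColor_iff_exists G H (by omega)]
  refine or_congr_right ⟨?_, ?_⟩
  · rintro ⟨a, b, h⟩
    let z : Fin (k + 1) → Fin k := fun _ => ⟨0, by omega⟩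
    exact ⟨a ∘ z, b ∘ z, wlEquiv_of_forall_fwlEquiv_comp hk fun f => h.comp (z ∘ f)⟩
  · rintro ⟨c, d, h⟩
    exact ⟨_, _, h.fwlEquiv_comp Fin.castSucc⟩

theorem oneWL_sameFinalColor_iff_tupleWL :
    (oneWL X).SameFinalColor G H ↔ (tupleWL 2 X).SameFinalColor G H := by
  rw [oneWL_sameFinalColor_iff, tupleWL_sameFinalColor_iff_exists G H (by omega)]
  constructor
  · rintro ⟨τ, hτ⟩
    rcases isEmpty_or_nonempty G.V with hV | ⟨⟨x⟩⟩
    · exact .inl ⟨hV, τ.symm.isEmpty⟩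
    · refine .inr ⟨fun _ => x, fun _ => τ x, wlEquiv_two_of_nodeEquiv τ hτ ?_ fun _ => hτ x⟩
      ext i j
      · simp [isoType]
      · exact hτ x 0
      · simp [isoType]
  · rintro (⟨hG, hH⟩ | ⟨c, d, h⟩)
    · exact ⟨Equiv.equivOfIsEmpty _ _, fun a => isEmptyElim a⟩
    · obtain ⟨σ, hσ⟩ := h.exists_equiv 0
      exact ⟨σ, fun w => by simpa using (hσ w).nodeEquiv 0⟩

end FinalColor

theorem kFWL_refining (k : ℕ) (X : Type u) : (kFWL.{u, v} k X).Refining := by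
  unfold kFWL
  split_ifs
  exacts [oneWL_refining X, tupleFWL_refining k X]

theorem kWL_refining (k : ℕ) (X : Type u) : (kWL.{u, v} k X).Refining := by
  unfold kWL
  split_ifs
  exacts [oneWL_refining X, tupleWL_refining k X]

theorem kFWL_sameFinalColor_iff (k : ℕ) (hk : 1 ≤ k) (G H : FeaturedGraph.{u, v} X) :
    (kFWL k X).SameFinalColor G H ↔ (kWL (k + 1) X).SameFinalColor G H := by
  unfold kFWL kWL
  rw [if_neg (show k + 1 ≠ 1 by omega)]
  split_ifs with h
  · subst h
    exact oneWL_sameFinalColor_iff_tupleWL G H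
  · exact tupleFWL_sameFinalColor_iff_tupleWL G H (by omega)

end KLWL

theorem mainTheorem6 {X : Type u} (k l : ℕ) (hk : 1 ≤ k) :
    KLWL.Algorithm.AsPowerfulAs
      (KLWL.klFWL.{u, v} k l X) (KLWL.klWL.{u, v} (k + 1) l X) :=
  KLWL.Algorithm.AsPowerfulAs.onLabeled (KLWL.kFWL_refining _ _) (KLWL.kWL_refining _ _)
    ⟨fun G H => (KLWL.kFWL_sameFinalColor_iff k hk G H).1,
      fun G H => (KLWL.kFWL_sameFinalColor_iff k hk G H).2⟩
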